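/- For a complex number $x$, a positive integer $\ell$ and an integer $m\ge 0$, let $H_m^{\langle \ell\rangle}(x)=\sum_{k=1}^{m}\frac{1}{(x+k)^{\ell}}$ (so $H_0^{\langle\ell\rangle}(x)=0$), and write $H_m(x)=H_m^{\langle 1\rangle}(x)$. For complex $z$ and an integer $m\ge 0$, let $\binom{z}{m}=\frac{z(z-1)\cdots(z-m+1)}{m!}$. Let $n\ge 2$ be an integer and let $x$ be a complex number such that $x\notin\{-1,-2,\dots,-(2n+1)\}$ and $xn+3n+1\neq 0$ (that is, no denominator below vanishes). Then $$\sum_{k=0}^{n}\binom{2n-k}{n}\binom{x+k}{k}k^2H_k^{\langle 2\rangle}(x)=\frac{(x+1)(xn+3n+1)}{8(n-1)}\binom{x+2n+1}{n-2}\Big\{4H_{2n+1}^{\langle 2\rangle}(x)+\tfrac{8(x^2+3x+n^2-n+1)}{n(x+1)(xn+3n+1)}$$ $$-\big[H_n(\tfrac{x}{2})-H_{n+1}(\tfrac{x-1}{2})\big]\big[H_n(\tfrac{x}{2})-H_{n+1}(\tfrac{x-1}{2})-\tfrac{4(x+n+1)(x^2+3x-2n+1)}{n(x+1)(xn+3n+1)}\big]\Big\}.$$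 -/

import Mathlib

/-- The generalized harmonic number of order `l`:
`H_n^{⟨l⟩}(x) = ∑_{k=1}^n 1 / (x + k)^l` for complex `x` (so the value at `n = 0` is `0`). -/
noncomputable def genHarmonic (l n : ℕ) (x : ℂ) : ℂ :=
  ∑ k ∈ Finset.Icc 1 n, 1 / (x + (k : ℂ)) ^ l

/-! With `u_k(y) = binom(x + k, k) / (x + 1 + k) * ∏_{1 ≤ j ≤ k} (1 - y² / (x + j)²)`, the sum is
minus the `y²`-coefficient of `∑ binom(2n - k, n) k² (x + 1 + k) u_k(y)`. The `u_k` are multiples of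
the terms of `₂F₁(x + 1 + y, x + 1 - y; x + 2; 1)`, so telescoping relations express this moment
through `P = ∑ binom(2n - k, n) (x + 1 + k) u_k` and `Q = ∑ binom(2n - k, n) u_k`, which are even in
`y`. Watson's summation evaluates `P + y Q` as a product proportional to
`∏_{0 ≤ i ≤ 2n} (1 + (-1)^i y / (x + 1 + i))`; its coefficients of `1`, `y`, `y²` are those of
`P`, `Q`, `P` at `1`, `1`, `y²` and carry the harmonic numbers. -/

open Finset Polynomial

section Binomial

theorem cast_sub_mul_choose_succ (R : Type*) [CommRing R] {m n : ℕ} (h : n ≤ m + 1) :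
    ((m : R) + 1 - n) * ((m + 1).choose n : R) = (m + 1) * (m.choose n : R) := by
  have key := congrArg (Nat.cast (R := R)) (Nat.choose_mul_succ_eq m n)
  push_cast [Nat.cast_sub h] at key
  linear_combination -key

theorem cast_succ_mul_choose_succ_succ (R : Type*) [CommSemiring R] (m n : ℕ) :
    ((n : R) + 1) * ((m + 1).choose (n + 1) : R) = (m + 1) * (m.choose n : R) := by
  rw [mul_comm]
  exact_mod_cast congrArg (Nat.cast (R := R)) (Nat.add_one_mul_choose_eq m n).symm

variable {R : Type*} [CommRing R] [BinomialRing R]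

theorem succ_mul_ringChoose_succ (z : R) (m : ℕ) :
    ((m : R) + 1) * Ring.choose (z + 1) (m + 1) = (z + 1) * Ring.choose z m := by
  simpa using Ring.choose_add_smul_choose z m 1

theorem factorial_mul_ringChoose_add (z : R) (m : ℕ) :
    (m.factorial : R) * Ring.choose (z + m) m = ∏ i ∈ range m, (z + 1 + i) := by
  induction m with
  | zero => simp
  | succ m ih =>
    rw [prod_range_succ, ← ih, Nat.factorial_succ]
    push_cast
    rw [← add_assoc z]
    linear_combination (m.factorial : R) * succ_mul_ringChoose_succ (z + m) m

theorem mul_prod_range_eq_mul_ringChoose {n : ℕ} (hn : 2 ≤ n) (z : R) :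
    (n * (n - 1) : R) * ∏ i ∈ range (2 * n + 1), (z + 1 + i)
      = (z + 1) * (z + n + 2) * (z + n + 3) * Ring.choose (z + 2 * n + 1) (n - 2)
        * (n.factorial * ∏ i ∈ range n, (z + 2 + i)) := by
  obtain ⟨m, rfl⟩ := Nat.exists_eq_add_of_le' hn
  have head : ∏ i ∈ range (m + 2), (z + 1 + ((i + 1 : ℕ) : R)) = ∏ i ∈ range (m + 2), (z + 2 + i) :=
    prod_congr rfl fun i _ => by push_cast; ring
  have tail : ∏ i ∈ range m, (z + 1 + ((m + 2 + 1 + 1 + 1 + i : ℕ) : R))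
      = m.factorial * Ring.choose (z + 2 * ((m + 2 : ℕ) : R) + 1) m := by
    rw [show z + 2 * ((m + 2 : ℕ) : R) + 1 = z + m + 5 + m by push_cast; ring,
      factorial_mul_ringChoose_add]
    exact prod_congr rfl fun i _ => by push_cast; ring
  rw [show 2 * (m + 2) + 1 = m + 2 + 1 + 1 + 1 + m by ring, prod_range_add, prod_range_succ,
    prod_range_succ, prod_range_succ', head, tail, Nat.add_sub_cancel, Nat.factorial_succ,
    Nat.factorial_succ]
  push_cast
  ring

end Binomial

section HypergeometricMoments

section Semiring

variable {R : Type*} [CommSemiring R]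

/-- The division-free recurrence, up to index `n`, satisfied by the multiples of the terms
`(a)_k (b)_k / (k! (c)_k)` of Gauss's series `₂F₁(a, b; c; 1)`. -/
def GaussRecurrence (a b c : R) (n : ℕ) (v : ℕ → R) : Prop :=
  ∀ k < n, ((k : R) + 1) * (c + k) * v (k + 1) = (a + k) * (b + k) * v k

/-- The `j`-th moment of `v` with respect to the weights `binom(2n - k, n)`, `0 ≤ k ≤ n`. -/
def chooseMoment (n j : ℕ) (v : ℕ → R) : R :=
  ∑ k ∈ range (n + 1), ((2 * n - k).choose n : R) * (k : R) ^ j * v k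

theorem chooseMoment_add_mul (n j : ℕ) (t : R) (v : ℕ → R) :
    chooseMoment n j (fun k => (t + k) * v k)
      = t * chooseMoment n j v + chooseMoment n (j + 1) v := by
  simp only [chooseMoment, mul_sum, ← sum_add_distrib]
  exact sum_congr rfl fun k _ => by ring

theorem coeff_chooseMoment (n j d : ℕ) (v : ℕ → R[X]) :
    (chooseMoment n j v).coeff d = chooseMoment n j fun k => (v k).coeff d := by
  simp only [chooseMoment, finsetSum_coeff]
  refine sum_congr rfl fun k _ => ?_
  rw [← coeff_C_mul]
  simp only [C_mul, C_pow, map_natCast]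

namespace GaussRecurrence

variable {a b c : R} {m n : ℕ} {v : ℕ → R}

theorem mono (hv : GaussRecurrence a b c n v) (hmn : m ≤ n) : GaussRecurrence a b c m v :=
  fun k hk => hv k (hk.trans_le hmn)

theorem raise_numerator (hv : GaussRecurrence a b c n v) :
    GaussRecurrence (a + 1) b c n fun k => (a + k) * v k := fun k hk =>
  calc ((k : R) + 1) * (c + k) * ((a + (k + 1 : ℕ)) * v (k + 1))
      = (a + k + 1) * (((k : R) + 1) * (c + k) * v (k + 1)) := by push_cast; ring
    _ = (a + 1 + k) * (b + k) * ((a + k) * v k) := by rw [hv k hk]; ring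

theorem lower_denominator (hv : GaussRecurrence a b (c + 1) n v) :
    GaussRecurrence a b c n fun k => (c + k) * v k := fun k hk =>
  calc ((k : R) + 1) * (c + k) * ((c + (k + 1 : ℕ)) * v (k + 1))
      = (c + k) * (((k : R) + 1) * (c + 1 + k) * v (k + 1)) := by push_cast; ring
    _ = (a + k) * (b + k) * ((c + k) * v k) := by rw [hv k hk]; ring

end GaussRecurrence

end Semiring

namespace GaussRecurrence

variable {R : Type*} [CommRing R] {a b c s y : R} {n : ℕ} {u v : ℕ → R}

theorem chooseMoment_two (hv : GaussRecurrence a b c n v) :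
    (n + a + b + 2 - c) * chooseMoment n 2 v
      = (n * (a + b) - a * b - (2 * n + 1) * (c - 1)) * chooseMoment n 1 v
        + n * a * b * chooseMoment n 0 v := by
  set T : ℕ → R := fun k =>
    (k : R) * (c + k - 1) * (2 * n + 1 - k) * ((2 * n - k).choose n : R) * v k with hT
  have shift : ∀ k ∈ range n,
      ((2 * n - k).choose n : R) * ((n - k) * (a + k) * (b + k) * v k) = T (k + 1) := by
    intro k hk
    obtain ⟨m, rfl⟩ := Nat.exists_eq_add_of_le' (mem_range.mp hk)
    have weight := cast_sub_mul_choose_succ R (show m + (k + 1) ≤ m + (k + 1) + m + 1 by omega)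
    have ratio := hv k (by omega)
    simp only [hT, show 2 * (m + (k + 1)) - (k + 1) = m + (k + 1) + m by omega,
      show 2 * (m + (k + 1)) - k = m + (k + 1) + m + 1 by omega]
    push_cast at weight ⊢
    linear_combination -((m : R) + 1) * ((m + (k + 1) + m + 1).choose (m + (k + 1)) : R) * ratio
      + ((k : R) + 1) * (c + k) * v (k + 1) * weight
  have telescope : ∑ k ∈ range (n + 1),
      ((2 * n - k).choose n : R) * ((n - k) * (a + k) * (b + k) * v k)
        = ∑ k ∈ range (n + 1), T k := by
    rw [sum_range_succ, sum_range_succ' T, sum_congr rfl shift]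
    simp [hT]
  rw [← sub_eq_zero] at telescope ⊢
  rw [← neg_eq_zero, ← telescope]
  simp only [chooseMoment, hT, mul_sum, ← sum_sub_distrib, ← sum_add_distrib, ← sum_neg_distrib]
  exact sum_congr rfl fun k _ => by ring

theorem chooseMoment_zero_succ (habc : a + b + 1 = 2 * c) (hv : GaussRecurrence a b c (n + 1) v) :
    ((n : R) + 1) * (c + n) * chooseMoment (n + 1) 0 v
      = (a + 2 * n + 1) * (b + 2 * n + 1) * chooseMoment n 0 v := by
  set T : ℕ → R := fun k => (k : R) * (c + k - 1) * ((2 * n + 1 - k).choose n : R) * v k with hT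
  have difference : ∀ k ∈ range (n + 1),
      ((n : R) + 1) * (c + n) * (((2 * (n + 1) - k).choose (n + 1) : R) * (k : R) ^ 0 * v k)
        = (a + 2 * n + 1) * (b + 2 * n + 1) * (((2 * n - k).choose n : R) * (k : R) ^ 0 * v k)
          + (T k - T (k + 1)) := by
    intro k hk
    have hk : k ≤ n := mem_range_succ_iff.mp hk
    have weight := cast_sub_mul_choose_succ R (show n ≤ 2 * n - k + 1 by omega)
    have weight' := cast_succ_mul_choose_succ_succ R (2 * n + 1 - k) n
    have ratio := hv k (by omega)
    simp only [hT, show 2 * n + 1 - (k + 1) = 2 * n - k by omega]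
    rw [show 2 * n - k + 1 = 2 * n + 1 - k by omega, Nat.cast_sub (by omega)] at weight
    rw [show 2 * n + 1 - k + 1 = 2 * (n + 1) - k by omega, Nat.cast_sub (by omega)] at weight'
    obtain rfl : b = 2 * c - 1 - a := by linear_combination habc
    push_cast at weight weight' ⊢
    linear_combination (c + n) * v k * weight' + ((2 * n - k).choose n : R) * ratio
      + (2 * c + 2 * n + k) * v k * weight
  have boundary : ((n : R) + 1) * (c + n)
      * (((2 * (n + 1) - (n + 1)).choose (n + 1) : R) * ((n + 1 : ℕ) : R) ^ 0 * v (n + 1))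
        = T (n + 1) := by
    simp only [hT, show 2 * n + 1 - (n + 1) = n by omega,
      show 2 * (n + 1) - (n + 1) = n + 1 by omega, Nat.choose_self]
    push_cast
    ring
  rw [chooseMoment, chooseMoment, sum_range_succ, mul_add, boundary, mul_sum,
    sum_congr rfl difference, sum_add_distrib, ← mul_sum, sum_range_sub']
  simp [hT]

theorem watson (habc : a + b + 1 = 2 * c) (hv : GaussRecurrence a b c n v) :
    (n.factorial : R) * (∏ i ∈ range n, (c + i)) * chooseMoment n 0 v
      = v 0 * ∏ i ∈ range n, ((a + 2 * i + 1) * (b + 2 * i + 1)) := by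
  induction n with
  | zero => simp [chooseMoment]
  | succ n ih =>
    rw [prod_range_succ, prod_range_succ, Nat.factorial_succ]
    push_cast
    linear_combination (n.factorial : R) * (∏ i ∈ range n, (c + i)) * chooseMoment_zero_succ habc hv
      + (a + 2 * n + 1) * (b + 2 * n + 1) * ih (hv.mono n.le_succ)

theorem watson_alternating (hu : GaussRecurrence (s + y) (s - y) (s + 1) n u) :
    (n.factorial : R) * (∏ i ∈ range n, (s + 1 + i))
        * chooseMoment n 0 (fun k => (s + y + k) * u k)
      = u 0 * ∏ i ∈ range (2 * n + 1), (s + i + (-1) ^ i * y) := by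
  have pairing : (s + y) * ∏ i ∈ range n, ((s + y + 1 + 2 * i + 1) * (s - y + 2 * i + 1))
      = ∏ i ∈ range (2 * n + 1), (s + i + (-1) ^ i * y) := by
    clear hu
    induction n with
    | zero => simp
    | succ n ih =>
      rw [prod_range_succ, ← mul_assoc, ih, show 2 * (n + 1) + 1 = 2 * n + 1 + 1 + 1 by ring,
        prod_range_succ _ (2 * n + 1 + 1), prod_range_succ _ (2 * n + 1)]
      simp only [pow_succ, pow_mul]
      push_cast
      ring
  rw [watson (by ring) hu.raise_numerator, ← pairing]
  push_cast
  ring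

theorem chooseMoment_two_mul (hu : GaussRecurrence (s + y) (s - y) (s + 1) n u) :
    ((n : R) + s + 1) * (n + s + 2) * chooseMoment n 2 (fun k => (s + k) * u k)
      = ((2 * n + 1 - s - (s ^ 2 - y ^ 2)) * (n * s + y ^ 2)
            + n * (n + s + 1) * (s ^ 2 - y ^ 2)) * chooseMoment n 0 (fun k => (s + k) * u k)
        - (2 * n + 1 - s - (s ^ 2 - y ^ 2)) * (n + s) * y ^ 2 * chooseMoment n 0 u := by
  have second := hu.chooseMoment_two
  have second' := hu.lower_denominator.chooseMoment_two
  have zeroth := chooseMoment_add_mul n 0 s u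
  have first := chooseMoment_add_mul n 1 s u
  linear_combination (n + s + 1) * second' + (2 * n + 1 - s - (s ^ 2 - y ^ 2))
    * (second + (n + s + 1) * first - (n * s + y ^ 2) * zeroth)

end GaussRecurrence

end HypergeometricMoments

section ProductCoefficients

section Semiring

variable {R ι : Type*} [CommSemiring R] (t : Finset ι) (r : ι → R)

theorem coeff_zero_prod_one_add : (∏ i ∈ t, (1 + C (r i) * X)).coeff 0 = 1 := by
  simp [coeff_zero_prod]

theorem coeff_one_prod_one_add : (∏ i ∈ t, (1 + C (r i) * X)).coeff 1 = ∑ i ∈ t, r i := by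
  classical
  induction t using Finset.induction_on with
  | empty => simp [coeff_one]
  | insert i t hi ih =>
    rw [prod_insert hi, sum_insert hi, add_mul, mul_assoc, coeff_add, coeff_C_mul, coeff_X_mul,
      coeff_zero_prod_one_add, one_mul, ih, mul_one, add_comm]

end Semiring

variable {R ι : Type*} [CommRing R] (t : Finset ι) (r : ι → R)

theorem two_mul_coeff_two_prod_one_add :
    2 * (∏ i ∈ t, (1 + C (r i) * X)).coeff 2 = (∑ i ∈ t, r i) ^ 2 - ∑ i ∈ t, r i ^ 2 := by
  classical
  induction t using Finset.induction_on with
  | empty => simp [coeff_one]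
  | insert i t hi ih =>
    rw [prod_insert hi, sum_insert hi, sum_insert hi, add_mul, mul_assoc, coeff_add, coeff_C_mul,
      coeff_X_mul, coeff_one_prod_one_add, one_mul]
    linear_combination ih

theorem prod_one_sub_sq_eq_expand :
    ∏ i ∈ t, (1 - C (r i) * X ^ 2) = expand R 2 (∏ i ∈ t, (1 + C (-r i) * X)) := by
  simp [map_prod, sub_eq_add_neg]

theorem coeff_one_prod_one_sub_sq : (∏ i ∈ t, (1 - C (r i) * X ^ 2)).coeff 1 = 0 := by
  rw [prod_one_sub_sq_eq_expand, coeff_expand two_pos, if_neg (by norm_num)]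

theorem coeff_two_prod_one_sub_sq :
    (∏ i ∈ t, (1 - C (r i) * X ^ 2)).coeff 2 = -∑ i ∈ t, r i := by
  rw [prod_one_sub_sq_eq_expand, coeff_expand two_pos, if_pos dvd_rfl, Nat.div_self two_pos,
    coeff_one_prod_one_add, sum_neg_distrib]

theorem prod_C_add_mul_X_eq {K : Type*} [Field K] {a b : ι → K} (ha : ∀ i ∈ t, a i ≠ 0) :
    ∏ i ∈ t, (C (a i) + C (b i) * X) = C (∏ i ∈ t, a i) * ∏ i ∈ t, (1 + C (b i / a i) * X) := by
  rw [map_prod, ← prod_mul_distrib]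
  refine prod_congr rfl fun i hi => ?_
  rw [mul_add, mul_one, ← mul_assoc, ← C_mul, mul_div_cancel₀ _ (ha i hi)]

end ProductCoefficients

theorem genHarmonic_eq_sum_range (l n : ℕ) (x : ℂ) :
    genHarmonic l n x = ∑ i ∈ range n, 1 / (x + 1 + i) ^ l := by
  rw [genHarmonic, ← Ico_add_one_right_eq_Icc, sum_Ico_eq_sum_range, Nat.add_sub_cancel]
  exact sum_congr rfl fun i _ => by push_cast; rw [← add_assoc]

/-- The alternating harmonic number `∑_{1 ≤ j ≤ n} (-1)^(j - 1) / (x + j)`, indexed from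
`i = j - 1`. It is the linear coefficient of the normalized product in Watson's
summation. -/
noncomputable def altHarmonic (n : ℕ) (x : ℂ) : ℂ :=
  ∑ i ∈ range n, (-1) ^ i / (x + 1 + i)

theorem altHarmonic_two_mul_add_one (n : ℕ) (x : ℂ) :
    altHarmonic (2 * n + 1) x
      = (genHarmonic 1 (n + 1) ((x - 1) / 2) - genHarmonic 1 n (x / 2)) / 2 := by
  have halve : ∀ z w : ℂ, w = z / 2 → 1 / z = 1 / w ^ 1 / 2 := by
    rintro z _ rfl
    rw [pow_one, one_div_div, div_div_cancel_left' two_ne_zero, one_div]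
  simp only [altHarmonic, genHarmonic_eq_sum_range]
  induction n with
  | zero => simpa using halve (x + 1) ((x - 1) / 2 + 1) (by ring)
  | succ n ih =>
    rw [show 2 * (n + 1) + 1 = 2 * n + 1 + 1 + 1 by ring, sum_range_succ, sum_range_succ, ih,
      sum_range_succ _ (n + 1), sum_range_succ (fun i : ℕ => 1 / (x / 2 + 1 + (i : ℂ)) ^ 1)]
    have odd := halve (x + 1 + (2 * n + 1 : ℕ)) (x / 2 + 1 + n) (by push_cast; ring)
    have even := halve (x + 1 + (2 * n + 1 + 1 : ℕ)) ((x - 1) / 2 + 1 + (n + 1 : ℕ))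
      (by push_cast; ring)
    rw [pow_succ (-1) (2 * n + 1), pow_succ (-1) (2 * n), pow_mul, neg_one_sq, one_pow]
    linear_combination even - odd

/-- The polynomial `binom(x + k, k) / (x + 1 + k) * ∏_{1 ≤ j ≤ k} (1 - y² / (x + j)²)` in `y = X`,
whose `y²`-coefficient carries the harmonic number of order two. -/
noncomputable def deformedTerm (x : ℂ) (k : ℕ) : ℂ[X] :=
  C (Ring.choose (x + k) k / (x + 1 + k))
    * ∏ i ∈ range k, (1 - C (1 / (x + 1 + i) ^ 2) * X ^ 2)

theorem coeff_one_deformedTerm (x : ℂ) (k : ℕ) : (deformedTerm x k).coeff 1 = 0 := by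
  rw [deformedTerm, coeff_C_mul, coeff_one_prod_one_sub_sq, mul_zero]

theorem coeff_two_deformedTerm (x : ℂ) (k : ℕ) :
    (deformedTerm x k).coeff 2 = -(Ring.choose (x + k) k / (x + 1 + k) * genHarmonic 2 k x) := by
  rw [deformedTerm, coeff_C_mul, coeff_two_prod_one_sub_sq, genHarmonic_eq_sum_range, mul_neg]

theorem coeff_one_chooseMoment_deformedTerm (n j : ℕ) (x : ℂ) :
    (chooseMoment n j (deformedTerm x)).coeff 1 = 0 := by
  rw [coeff_chooseMoment]
  simp only [chooseMoment, coeff_one_deformedTerm, mul_zero, sum_const_zero]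

/-- The left-hand side of Watson's summation for the deformed terms: its even and odd parts in `y`
are the two basic moments. -/
noncomputable def watsonPolynomial (n : ℕ) (x : ℂ) : ℂ[X] :=
  chooseMoment n 0 fun k => (C (x + 1) + X + (k : ℂ[X])) * deformedTerm x k

theorem watsonPolynomial_eq_add_mul_X (n : ℕ) (x : ℂ) :
    watsonPolynomial n x
      = chooseMoment n 0 (fun k => (C (x + 1) + (k : ℂ[X])) * deformedTerm x k)
        + chooseMoment n 0 (deformedTerm x) * X := by
  simp only [watsonPolynomial, chooseMoment_add_mul]
  ring

theorem coeff_zero_watsonPolynomial (n : ℕ) (x : ℂ) :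
    (watsonPolynomial n x).coeff 0
      = (chooseMoment n 0 fun k => (C (x + 1) + (k : ℂ[X])) * deformedTerm x k).coeff 0 := by
  rw [watsonPolynomial_eq_add_mul_X, coeff_add, coeff_mul_X_zero, add_zero]

theorem coeff_one_watsonPolynomial (n : ℕ) (x : ℂ) :
    (watsonPolynomial n x).coeff 1 = (chooseMoment n 0 (deformedTerm x)).coeff 0 := by
  rw [watsonPolynomial_eq_add_mul_X, coeff_add, coeff_mul_X, chooseMoment_add_mul, coeff_add,
    coeff_C_mul, coeff_one_chooseMoment_deformedTerm, coeff_one_chooseMoment_deformedTerm,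
    mul_zero, zero_add, zero_add]

theorem coeff_two_watsonPolynomial (n : ℕ) (x : ℂ) :
    (watsonPolynomial n x).coeff 2
      = (chooseMoment n 0 fun k => (C (x + 1) + (k : ℂ[X])) * deformedTerm x k).coeff 2 := by
  rw [watsonPolynomial_eq_add_mul_X, coeff_add, coeff_mul_X, coeff_one_chooseMoment_deformedTerm,
    add_zero]

section DeformedMoments

variable {n : ℕ} {x : ℂ} (hx : ∀ i ≤ n, x + 1 + (i : ℂ) ≠ 0)
include hx

theorem gaussRecurrence_deformedTerm :
    GaussRecurrence (C (x + 1) + X) (C (x + 1) - X) (C (x + 1) + 1) n (deformedTerm x) := by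
  intro k hk
  have h₁ : x + 1 + k ≠ 0 := hx k hk.le
  have h₂ : x + 1 + (k + 1) ≠ 0 := by simpa using hx (k + 1) hk
  have choose_ratio : ((k : ℂ) + 1) * (x + 1 + 1 + k)
      * (Ring.choose (x + (k + 1 : ℕ)) (k + 1) / (x + 1 + (k + 1 : ℕ)))
        = (x + 1 + k) ^ 2 * (Ring.choose (x + k) k / (x + 1 + k)) := by
    have key := succ_mul_ringChoose_succ (x + k) k
    push_cast
    rw [← add_assoc x]
    field_simp
    linear_combination (x + 1 + 1 + k) * key
  have factor : (x + 1 + k) ^ 2 * (1 / (x + 1 + k) ^ 2) = 1 := mul_one_div_cancel (pow_ne_zero 2 h₁)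
  have choose_ratio := congrArg (C : ℂ → ℂ[X]) choose_ratio
  have factor := congrArg (C : ℂ → ℂ[X]) factor
  rw [deformedTerm, deformedTerm, prod_range_succ]
  generalize ∏ i ∈ range k, ((1 : ℂ[X]) - C (1 / (x + 1 + i) ^ 2) * X ^ 2) = p
  generalize Ring.choose (x + (k + 1 : ℕ)) (k + 1) / (x + 1 + (k + 1 : ℕ)) = β' at *
  generalize Ring.choose (x + k) k / (x + 1 + k) = β at *
  generalize 1 / (x + 1 + (k : ℂ)) ^ 2 = r at *
  simp only [C_add, C_mul, C_pow, C_1, map_natCast] at choose_ratio factor ⊢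
  linear_combination p * (1 - C r * X ^ 2) * choose_ratio - C β * p * X ^ 2 * factor

theorem sum_choose_mul_genHarmonic_eq_neg_coeff :
    ∑ k ∈ range (n + 1),
        ((2 * n - k).choose n : ℂ) * Ring.choose (x + (k : ℂ)) k * (k : ℂ) ^ 2 * genHarmonic 2 k x
      = -(chooseMoment n 2 fun k => (C (x + 1) + (k : ℂ[X])) * deformedTerm x k).coeff 2 := by
  rw [coeff_chooseMoment, chooseMoment, ← sum_neg_distrib]
  refine sum_congr rfl fun k hk => ?_
  have h : x + 1 + k ≠ 0 := hx k (mem_range_succ_iff.mp hk)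
  rw [← map_natCast (C : ℂ →+* ℂ[X]) k, ← C_add, coeff_C_mul, coeff_two_deformedTerm]
  field_simp

theorem mul_coeff_two_chooseMoment_two :
    (x + n + 2) * (x + n + 3)
        * (chooseMoment n 2 fun k => (C (x + 1) + (k : ℂ[X])) * deformedTerm x k).coeff 2
      = n * (x + 1) * (x * n + 3 * n + 1) * (watsonPolynomial n x).coeff 2
        - (x ^ 2 + 3 * x + n ^ 2 - n + 1) * (watsonPolynomial n x).coeff 0
        + (x + n + 1) * (x ^ 2 + 3 * x - 2 * n + 1) * (watsonPolynomial n x).coeff 1 := by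
  have moment := (gaussRecurrence_deformedTerm hx).chooseMoment_two_mul
  rw [coeff_zero_watsonPolynomial, coeff_one_watsonPolynomial, coeff_two_watsonPolynomial]
  generalize (chooseMoment n 0 fun k => (C (x + 1) + (k : ℂ[X])) * deformedTerm x k) = P at *
  generalize chooseMoment n 0 (deformedTerm x) = Q at *
  generalize (chooseMoment n 2 fun k => (C (x + 1) + (k : ℂ[X])) * deformedTerm x k) = M at *
  have expansion : C ((x + n + 2) * (x + n + 3)) * M
      = C (n * (x + 1) * (x * n + 3 * n + 1)) * P
        - C (x ^ 2 + 3 * x + n ^ 2 - n + 1) * P * X ^ 2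
        + C ((x + n + 1) * (x ^ 2 + 3 * x - 2 * n + 1)) * Q * X ^ 2
        + (P - C (x + n + 1) * Q) * X ^ 4 := by
    simp only [C_add, C_sub, C_mul, C_pow, C_1, map_natCast, map_ofNat] at moment ⊢
    linear_combination moment
  simpa only [coeff_add, coeff_sub, coeff_mul_X_pow', coeff_C_mul, le_refl, Nat.sub_self,
    Nat.reduceLeDiff, if_true, if_false, add_zero] using congrArg (coeff · 2) expansion

theorem mul_watsonPolynomial_eq :
    C ((x + 1) * (n.factorial * ∏ i ∈ range n, (x + 2 + i))) * watsonPolynomial n x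
      = ∏ i ∈ range (2 * n + 1), (C (x + 1 + i) + C ((-1) ^ i) * X) := by
  have initial : C (x + 1) * deformedTerm x 0 = 1 := by
    have hx1 : x + 1 ≠ 0 := by simpa using hx 0 n.zero_le
    rw [deformedTerm, prod_range_zero, mul_one, ← C_mul]
    simp [hx1]
  have denominator : C (n.factorial * ∏ i ∈ range n, (x + 2 + (i : ℂ)))
      = (n.factorial : ℂ[X]) * ∏ i ∈ range n, (C (x + 1) + 1 + (i : ℂ[X])) := by
    rw [C_mul, map_prod, map_natCast]
    congr 1
    refine prod_congr rfl fun i _ => ?_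
    simp only [C_add, C_1, map_natCast, map_ofNat]
    ring
  have watson := (gaussRecurrence_deformedTerm hx).watson_alternating
  rw [← watsonPolynomial, ← denominator] at watson
  rw [C_mul, mul_assoc, watson, ← mul_assoc, initial, one_mul]
  simp

end DeformedMoments

section Watson

variable {n : ℕ} {x : ℂ} (hx : ∀ i ≤ 2 * n, x + 1 + (i : ℂ) ≠ 0)
include hx

theorem watsonPolynomial_eq_prod (hn : 2 ≤ n) :
    C ((n : ℂ) * (n - 1)) * watsonPolynomial n x
      = C ((x + n + 2) * (x + n + 3) * Ring.choose (x + 2 * n + 1) (n - 2))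
        * ∏ i ∈ range (2 * n + 1), (1 + C ((-1) ^ i / (x + 1 + i)) * X) := by
  set D : ℂ := (x + 1) * (n.factorial * ∏ i ∈ range n, (x + 2 + i)) with hD
  have hx1 : x + 1 ≠ 0 := by simpa using hx 0 (by omega)
  have hD0 : D ≠ 0 := by
    refine mul_ne_zero hx1 (mul_ne_zero (Nat.cast_ne_zero.mpr n.factorial_ne_zero)
      (prod_ne_zero_iff.mpr fun i hi => ?_))
    convert hx (i + 1) (by have := mem_range.mp hi; omega) using 1
    push_cast
    ring
  have binomial : (n : ℂ) * (n - 1) * ∏ i ∈ range (2 * n + 1), (x + 1 + i)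
      = D * ((x + n + 2) * (x + n + 3) * Ring.choose (x + 2 * n + 1) (n - 2)) := by
    rw [mul_prod_range_eq_mul_ringChoose hn, hD]
    ring
  have watson := mul_watsonPolynomial_eq (n := n) fun i hi => hx i (by omega)
  rw [← hD, prod_C_add_mul_X_eq _ fun i hi => hx i (mem_range_succ_iff.mp hi)] at watson
  refine mul_left_cancel₀ (C_ne_zero.mpr hD0) ?_
  rw [mul_left_comm, watson, ← mul_assoc, ← C_mul, binomial, C_mul, mul_assoc]

theorem mul_sum_choose_mul_genHarmonic_eq (hn : 2 ≤ n) :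
    (n : ℂ) * (n - 1) * ∑ k ∈ range (n + 1),
        ((2 * n - k).choose n : ℂ) * Ring.choose (x + (k : ℂ)) k * (k : ℂ) ^ 2 * genHarmonic 2 k x
      = Ring.choose (x + 2 * n + 1) (n - 2)
        * (n * (x + 1) * (x * n + 3 * n + 1)
              * (genHarmonic 2 (2 * n + 1) x - altHarmonic (2 * n + 1) x ^ 2) / 2
            + (x ^ 2 + 3 * x + n ^ 2 - n + 1)
            - (x + n + 1) * (x ^ 2 + 3 * x - 2 * n + 1) * altHarmonic (2 * n + 1) x) := by
  set W := ∏ i ∈ range (2 * n + 1), (1 + C ((-1) ^ i / (x + 1 + (i : ℂ))) * X) with hW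
  have W_zero : W.coeff 0 = 1 := coeff_zero_prod_one_add ..
  have W_one : W.coeff 1 = altHarmonic (2 * n + 1) x := coeff_one_prod_one_add ..
  have W_two : 2 * W.coeff 2 = altHarmonic (2 * n + 1) x ^ 2 - genHarmonic 2 (2 * n + 1) x := by
    rw [hW, two_mul_coeff_two_prod_one_add, genHarmonic_eq_sum_range]
    simp [altHarmonic, div_pow, ← pow_mul]
  have coeff_watson (d : ℕ) := congrArg (coeff · d) (watsonPolynomial_eq_prod hx hn)
  simp only [coeff_C_mul, ← hW] at coeff_watson
  have zeroth := coeff_watson 0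
  have first := coeff_watson 1
  have second := coeff_watson 2
  have moment := mul_coeff_two_chooseMoment_two (n := n) fun i hi => hx i (by omega)
  rw [W_zero] at zeroth
  rw [W_one] at first
  have h₂ : x + n + 2 ≠ 0 := by
    convert hx (n + 1) (by omega) using 1
    push_cast
    ring
  have h₃ : x + n + 3 ≠ 0 := by
    convert hx (n + 2) (by omega) using 1
    push_cast
    ring
  rw [sum_choose_mul_genHarmonic_eq_neg_coeff fun i hi => hx i (by omega)]
  refine mul_left_cancel₀ (mul_ne_zero h₂ h₃) ?_
  linear_combination -(n : ℂ) * (n - 1) * moment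
    + (x ^ 2 + 3 * x + n ^ 2 - n + 1) * zeroth
    - (x + n + 1) * (x ^ 2 + 3 * x - 2 * n + 1) * first
    - n * (x + 1) * (x * n + 3 * n + 1) * (second + (x + n + 2) * (x + n + 3)
      * Ring.choose (x + 2 * n + 1) (n - 2) / 2 * W_two)

end Watson

theorem theorem6 (n : ℕ) (hn : 2 ≤ n) (x : ℂ)
    (hx : ∀ k : ℕ, 1 ≤ k → k ≤ 2 * n + 1 → x ≠ -(k : ℂ))
    (hq : x * (n : ℂ) + 3 * (n : ℂ) + 1 ≠ 0) :
    (∑ k ∈ Finset.range (n + 1),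
        ((2 * n - k).choose n : ℂ) * Ring.choose (x + (k : ℂ)) k * (k : ℂ) ^ 2
          * genHarmonic 2 k x)
      = (x + 1) * (x * (n : ℂ) + 3 * (n : ℂ) + 1) / (8 * ((n : ℂ) - 1))
          * Ring.choose (x + 2 * (n : ℂ) + 1) (n - 2)
          * (4 * genHarmonic 2 (2 * n + 1) x
              + 8 * (x ^ 2 + 3 * x + (n : ℂ) ^ 2 - (n : ℂ) + 1)
                  / ((n : ℂ) * (x + 1) * (x * (n : ℂ) + 3 * (n : ℂ) + 1))
              - (genHarmonic 1 n (x / 2) - genHarmonic 1 (n + 1) ((x - 1) / 2))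
                * (genHarmonic 1 n (x / 2) - genHarmonic 1 (n + 1) ((x - 1) / 2)
                    - 4 * (x + (n : ℂ) + 1) * (x ^ 2 + 3 * x - 2 * (n : ℂ) + 1)
                        / ((n : ℂ) * (x + 1) * (x * (n : ℂ) + 3 * (n : ℂ) + 1)))) := by
  have hx' : ∀ i ≤ 2 * n, x + 1 + (i : ℂ) ≠ 0 := fun i hi h =>
    hx (i + 1) (by omega) (by omega) (by push_cast; linear_combination h)
  have hx1 : x + 1 ≠ 0 := by simpa using hx' 0 (by omega)
  have hn0 : (n : ℂ) ≠ 0 := Nat.cast_ne_zero.mpr (by omega)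
  have hn1 : (n : ℂ) - 1 ≠ 0 := sub_ne_zero.mpr (by exact_mod_cast (by omega : n ≠ 1))
  have cleared := mul_sum_choose_mul_genHarmonic_eq hx' hn
  rw [altHarmonic_two_mul_add_one] at cleared
  refine mul_left_cancel₀ (mul_ne_zero hn0 hn1) (cleared.trans ?_)
  generalize x * (n : ℂ) + 3 * n + 1 = q at hq ⊢
  field_simp
  ring
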